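/- Let $k\ge 0$ be an integer and let $D$ be a finite oriented graph, that is, a directed graph on $n$ vertices without loops and without multiple or anti-parallel arcs. Suppose that $D$ has treewidth (at most) $k$, meaning that its underlying undirected graph is a subgraph of a $k$-tree. Here a finite graph $T$ is a $k$-tree if its vertices can be ordered $v_1,\dots,v_m$ so that for every $i$ the neighbours of $v_i$ among $v_1,\dots,v_{i-1}$ form a clique of size exactly $\min(k,i-1)$. A feedback vertex set of $D$ is a set of vertices whose deletion leaves a directed graph without directed cycles, and $f(D)$ denotes the minimum size of a feedback vertex set of $D$. Then $$f(D)\le \frac{k}{k+3}\,n .$$ -/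

import Mathlib

namespace SimpleGraph

/-- The set of neighbours of `v` in `G` that precede `v` in the ordering `φ`. -/
def predecessors {V : Type*} [Fintype V] (G : SimpleGraph V) (φ : V ≃ Fin (Fintype.card V))
    (v : V) : Set V :=
  {u | φ u < φ v ∧ G.Adj u v}

/-- `G` is a `k`-tree: the vertices can be ordered so that the earlier neighbours of each vertex
form a clique and each vertex has `min k i` earlier neighbours, where `i` is the number of
vertices that precede it. (Positions are counted from `0`.) -/
def IsKTree {V : Type*} [Fintype V] (G : SimpleGraph V) (k : ℕ) : Prop :=
  ∃ φ : V ≃ Fin (Fintype.card V), ∀ v : V,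
    G.IsClique (G.predecessors φ v) ∧ (G.predecessors φ v).ncard = min k (φ v : ℕ)

/-- `G` is a subgraph of a (finite) `k`-tree, which may have more vertices than `G`.
This is the property that the treewidth of `G` is at most `k`. -/
def HasTreewidth {V : Type*} (G : SimpleGraph V) (k : ℕ) : Prop :=
  ∃ (m : ℕ) (T : SimpleGraph (Fin m)), T.IsKTree k ∧ G.IsContained T

end SimpleGraph

namespace Digraph

/-- An oriented graph: no anti-parallel arcs and (taking `u = v`) no loops. -/
def IsOriented {V : Type*} (D : Digraph V) : Prop :=
  ∀ u v : V, D.Adj u v → ¬ D.Adj v u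

/-- The digraph `D - F`. -/
def deleteVertices {V : Type*} (D : Digraph V) (F : Finset V) : Digraph {v : V // v ∉ F} where
  Adj u v := D.Adj u v

/-- `D` has a directed cycle: distinct vertices `c 0, …, c m` with arcs `c i → c (i + 1)`,
where indices are taken modulo `m + 1`. -/
def HasDirectedCycle {V : Type*} (D : Digraph V) : Prop :=
  ∃ (m : ℕ) (c : Fin (m + 1) → V), Function.Injective c ∧ ∀ i, D.Adj (c i) (c (i + 1))

/-- Deleting `F` leaves a digraph without directed cycles. -/
def IsFeedbackVertexSet {V : Type*} (D : Digraph V) (F : Finset V) : Prop :=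
  ¬ (D.deleteVertices F).HasDirectedCycle

/-- The minimum size `f(D)` of a feedback vertex set of `D`. -/
noncomputable def feedbackNumber {V : Type*} (D : Digraph V) : ℕ :=
  sInf {s : ℕ | ∃ F : Finset V, D.IsFeedbackVertexSet F ∧ F.card = s}

/-- The minimum in the definition of `feedbackNumber` is attained. -/
theorem exists_isFeedbackVertexSet_card_eq {V : Type*} [Fintype V] (D : Digraph V) :
    ∃ F : Finset V, D.IsFeedbackVertexSet F ∧ F.card = D.feedbackNumber :=
  Nat.sInf_mem (s := {s : ℕ | ∃ F : Finset V, D.IsFeedbackVertexSet F ∧ F.card = s})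
    ⟨_, Finset.univ, fun ⟨_, c, _⟩ => (c 0).2 (Finset.mem_univ _), rfl⟩

end Digraph

/-! Adding arcs can only increase the feedback number, so `exists_isElimination_of_hasTreewidth`
completes `D` to an orientation of a chordal graph, ordered so that the earlier neighbours of each
vertex form a clique of size at most `k`. There, a set meeting all directed triangles meets all
directed cycles (`IsElimination.isFeedbackVertexSet`), because a path through the last vertex can be
shortcut by an arc between its neighbours on the path.

It remains to hit the triangles with at most `kn/(k+3)` vertices. For `k ≤ 2` a colouring does this.
For `k ≥ 3`, induct: find disjoint `X` and `Y` with `3|X| ≤ k|Y|` such that deleting `X` frees `Y`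
from triangles, put `X` in the solution and discard `Y` (`exists_hitsTriangles_of_isSafe`).

To find such a pair, make the last earlier neighbour of a vertex its parent and work up from the
bottom of this forest. If there is no pair, every vertex starts a branch of one of three kinds: a
leaf, an edge or a directed triangle (`IsElimination.branch`). Any other configuration of child
branches yields a pair, with `X` taken mainly from the bag of the parent (the parent and its earlier
neighbours, at most `k+1` vertices) and `Y` mainly from the branches. The first vertex has no
earlier neighbours, and there each of the three kinds gives a pair after all. -/

namespace Digraph

/-! ### Directed triangles and reducible pairs -/

section Elimination

open scoped Classical

variable {V : Type*}

/-- `a` and `b` are joined by an arc, in one direction or the other. -/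
def Joined (D : Digraph V) (a b : V) : Prop := D.Adj a b ∨ D.Adj b a

theorem Joined.symm {D : Digraph V} {a b : V} (h : D.Joined a b) : D.Joined b a := Or.symm h

theorem IsOriented.irrefl {D : Digraph V} (hD : D.IsOriented) (a : V) : ¬ D.Adj a a :=
  fun h => hD a a h h

theorem IsOriented.not_joined_self {D : Digraph V} (hD : D.IsOriented) (a : V) : ¬ D.Joined a a := by
  rintro (h | h) <;> exact hD.irrefl a h

theorem card_insert_inter_le_one [DecidableEq V] {z : V} {R S : Finset V} (h : Disjoint R S) :
    (insert z R ∩ S).card ≤ 1 := by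
  refine le_trans (Finset.card_le_card (t := {z}) ?_) (by simp)
  intro x hx
  rw [Finset.mem_inter, Finset.mem_insert] at hx
  rcases hx.1 with rfl | h1
  · simp
  · exact (Finset.disjoint_left.1 h h1 hx.2).elim

/-- No directed triangle that avoids `X` meets `Y`. -/
def IsSafe (D : Digraph V) (X Y : Finset V) : Prop :=
  ∀ a ∈ Y, ∀ b c, b ∉ X → c ∉ X → D.Adj a b → D.Adj b c → D.Adj c a → False

/-- `X` meets all directed triangles of `D`. -/
def HitsTriangles (D : Digraph V) (X : Finset V) : Prop :=
  ∀ a b c, a ∉ X → b ∉ X → c ∉ X → D.Adj a b → D.Adj b c → D.Adj c a → False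

/-- Deleting `X` takes the vertices of `Y` out of all directed triangles, and `X` is small enough
compared to `Y`. -/
def IsReducible (D : Digraph V) (k : ℕ) : Prop :=
  ∃ X Y : Finset V, Disjoint X Y ∧ Y.Nonempty ∧ 3 * X.card ≤ k * Y.card ∧ D.IsSafe X Y

theorem IsSafe.mono {D : Digraph V} {X X' Y : Finset V} (h : D.IsSafe X Y) (hX : X ⊆ X') :
    D.IsSafe X' Y :=
  fun a ha b c hb hc => h a ha b c (fun h' => hb (hX h')) (fun h' => hc (hX h'))

theorem IsSafe.union [DecidableEq V] {D : Digraph V} {X Y Y' : Finset V} (h : D.IsSafe X Y)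
    (h' : D.IsSafe X Y') : D.IsSafe X (Y ∪ Y') :=
  fun a ha => (Finset.mem_union.1 ha).elim (h a) (h' a)

/-- For `k ≥ 3`, `3(k+j) ≤ k(3+j)`. The cases needed are `j = 0` and `j = 1`: `k` deletions for
three safe vertices, or `k+1` for four. -/
theorem isReducible_of_card {D : Digraph V} {k : ℕ} (hk : 3 ≤ k) (j : ℕ) {X Y : Finset V}
    (hXY : Disjoint X Y) (hX : X.card ≤ k + j) (hY : 3 + j ≤ Y.card) (h : D.IsSafe X Y) :
    D.IsReducible k := by
  refine ⟨X, Y, hXY, Finset.card_pos.1 (by omega), ?_, h⟩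
  nlinarith [Nat.mul_le_mul_left k hY, Nat.mul_le_mul_right j hk]

/-! ### Elimination orders -/

variable [Fintype V] [LinearOrder V]

/-- The vertices before `v` that are joined to `v`. -/
noncomputable def lower (D : Digraph V) (v : V) : Finset V :=
  Finset.univ.filter fun u => u < v ∧ D.Joined u v

theorem mem_lower {D : Digraph V} {u v : V} : u ∈ D.lower v ↔ u < v ∧ D.Joined u v := by
  simp [lower]

theorem notMem_lower_self {D : Digraph V} {v : V} : v ∉ D.lower v := by
  simp [lower]

/-- `D` is an oriented graph and the order is (the reverse of) a perfect elimination order of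
the underlying chordal graph, with at most `k` lower neighbours at each vertex. -/
structure IsElimination (D : Digraph V) (k : ℕ) : Prop where
  oriented : D.IsOriented
  clique : ∀ v, ∀ a ∈ D.lower v, ∀ b ∈ D.lower v, a ≠ b → D.Joined a b
  card_le : ∀ v, (D.lower v).card ≤ k

theorem IsElimination.deleteVertices {D : Digraph V} {k : ℕ} (h : D.IsElimination k)
    (F : Finset V) : (D.deleteVertices F).IsElimination k where
  oriented := fun u v huv hvu => h.oriented u v huv hvu
  clique := by
    intro v a ha b hb hab
    rw [mem_lower] at ha hb
    exact h.clique v a (mem_lower.2 ha) b (mem_lower.2 hb) (fun h => hab (Subtype.ext h))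
  card_le := by
    intro v
    refine le_trans ?_ (h.card_le v)
    refine Finset.card_le_card_of_injOn Subtype.val ?_ Subtype.val_injective.injOn
    intro a ha
    rw [Finset.mem_coe, mem_lower] at ha
    exact mem_lower.2 ha

/-! ### Acyclicity from the absence of directed triangles -/

/-- The arcs of `D` inside `U`. -/
def AdjIn (D : Digraph V) (U : Finset V) (a b : V) : Prop := a ∈ U ∧ b ∈ U ∧ D.Adj a b

/-- In a passage `u → v → c` both ends are earlier neighbours of `v`, hence joined; an arc `c → u`
would close a triangle avoiding `F`, so `u → c`. The clause for `b = v` remembers where the path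
entered `v`, so that the induction can continue past it. -/
theorem IsElimination.shortcut {D : Digraph V} {k : ℕ} (h : D.IsElimination k) {F : Finset V}
    (hF : D.HitsTriangles F) {U : Finset V} {v : V} (hv : ∀ x ∈ U, x < v) (hvF : v ∉ F)
    (hUF : ∀ x ∈ U, x ∉ F) {a b : V} (hab : Relation.TransGen (D.AdjIn (insert v U)) a b)
    (ha : a ∈ U) :
    (b ∈ U → Relation.TransGen (D.AdjIn U) a b) ∧
      (b = v → ∃ u ∈ U, Relation.ReflTransGen (D.AdjIn U) a u ∧ D.Adj u v) := by
  have hvU : v ∉ U := fun h => lt_irrefl _ (hv v h)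
  induction hab with
  | single hb =>
    refine ⟨fun hbU => .single ⟨ha, hbU, hb.2.2⟩, ?_⟩
    rintro rfl
    exact ⟨a, ha, .refl, hb.2.2⟩
  | @tail b c _ hbc ih =>
    obtain ⟨hb, hc, hadj⟩ := hbc
    rcases Finset.mem_insert.1 hb with rfl | hbU
    · obtain ⟨u, hu, hau, huv⟩ := ih.2 rfl
      refine ⟨fun hcU => ?_, ?_⟩
      · have huc : u ≠ c := by
          rintro rfl
          exact h.oriented _ _ huv hadj
        rcases h.clique b u (mem_lower.2 ⟨hv u hu, .inl huv⟩) c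
          (mem_lower.2 ⟨hv c hcU, .inr hadj⟩) huc with h1 | h1
        · exact .tail' hau ⟨hu, hcU, h1⟩
        · exact (hF u b c (hUF u hu) hvF (hUF c hcU) huv hadj h1).elim
      · rintro rfl
        exact (h.oriented.irrefl _ hadj).elim
    · have h1 := ih.1 hbU
      refine ⟨fun hcU => h1.tail ⟨hbU, hcU, hadj⟩, ?_⟩
      rintro rfl
      exact ⟨b, hbU, h1.to_reflTransGen, hadj⟩

theorem IsElimination.not_transGen {D : Digraph V} {k : ℕ} (h : D.IsElimination k) {F : Finset V}
    (hF : D.HitsTriangles F) (U : Finset V) (hUF : ∀ x ∈ U, x ∉ F) (a : V) :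
    ¬ Relation.TransGen (D.AdjIn U) a a := by
  induction U using Finset.induction_on_max generalizing a with
  | empty =>
    intro ha
    obtain ⟨b, hb, -⟩ := Relation.TransGen.head'_iff.1 ha
    simp [AdjIn] at hb
  | insert v U hv ih =>
    have ih := ih fun x hx => hUF x (Finset.mem_insert_of_mem hx)
    have key : ∀ a ∈ U, ¬ Relation.TransGen (D.AdjIn (insert v U)) a a := fun a ha haa =>
      ih a ((h.shortcut hF hv (hUF v (Finset.mem_insert_self _ _))
        (fun x hx => hUF x (Finset.mem_insert_of_mem hx)) haa ha).1 ha)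
    intro haa
    obtain ⟨b, hab, hba⟩ := Relation.TransGen.head'_iff.1 haa
    rcases Finset.mem_insert.1 hab.1 with rfl | haU
    · rcases Finset.mem_insert.1 hab.2.1 with rfl | hbU
      · exact h.oriented.irrefl _ hab.2.2
      · exact key b hbU (.tail' hba hab)
    · exact key a haU haa

theorem IsElimination.isFeedbackVertexSet {D : Digraph V} {k : ℕ} (h : D.IsElimination k)
    {F : Finset V} (hF : D.HitsTriangles F) : D.IsFeedbackVertexSet F := by
  rintro ⟨m, c, -, hc⟩
  have hstep : ∀ i, D.AdjIn Fᶜ (c i) (c (i + 1)) := fun i =>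
    ⟨Finset.mem_compl.2 (c i).2, Finset.mem_compl.2 (c (i + 1)).2, hc i⟩
  have hreach : ∀ n : ℕ, Relation.ReflTransGen (D.AdjIn Fᶜ) (c 0) (c (Fin.ofNat (m + 1) n)) := by
    intro n
    induction n with
    | zero => exact .refl
    | succ n ih =>
      have : Fin.ofNat (m + 1) (n + 1) = Fin.ofNat (m + 1) n + 1 := by
        ext; simp [Fin.val_add]
      rw [this]
      exact ih.tail (hstep _)
  have h0 : Fin.ofNat (m + 1) m + 1 = 0 := by
    ext; simp
  have hlast := hstep (Fin.ofNat (m + 1) m)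
  rw [h0] at hlast
  exact h.not_transGen hF Fᶜ (fun x hx => Finset.mem_compl.1 hx) _ (.tail' (hreach m) hlast)

/-! ### Small `k`: colourings -/

/-- Greedy colouring along the order: at most `k` colours are blocked at each vertex. -/
theorem IsElimination.exists_coloring {D : Digraph V} {k : ℕ} (h : D.IsElimination k) :
    ∃ col : V → Fin (k + 1), ∀ a b, D.Adj a b → col a ≠ col b := by
  suffices ∀ U : Finset V, ∃ col : V → Fin (k + 1),
      ∀ a ∈ U, ∀ b ∈ U, D.Adj a b → col a ≠ col b by
    obtain ⟨col, hcol⟩ := this Finset.univ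
    exact ⟨col, fun a b => hcol a (Finset.mem_univ _) b (Finset.mem_univ _)⟩
  intro U
  induction U using Finset.induction_on_max with
  | empty => exact ⟨fun _ => 0, by simp⟩
  | insert v U hv ih =>
    obtain ⟨col, hcol⟩ := ih
    obtain ⟨i, hi⟩ : ∃ i, i ∉ (D.lower v).image col := by
      by_contra! hall
      have h1 : (Finset.univ : Finset (Fin (k + 1))).card ≤ ((D.lower v).image col).card :=
        Finset.card_le_card fun i _ => hall i
      have h2 := Finset.card_image_le (s := D.lower v) (f := col)
      have h3 := h.card_le v
      simp at h1
      omega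
    have hi' : ∀ u ∈ U, D.Joined u v → col u ≠ i := fun u hu huv he =>
      hi (Finset.mem_image.2 ⟨u, mem_lower.2 ⟨hv u hu, huv⟩, he⟩)
    refine ⟨Function.update col v i, ?_⟩
    intro a ha b hb hab
    rcases Finset.mem_insert.1 ha with rfl | ha' <;> rcases Finset.mem_insert.1 hb with rfl | hb'
    · exact (h.oriented.irrefl _ hab).elim
    · rw [Function.update_self, Function.update_of_ne (hv b hb').ne]
      exact (hi' b hb' (.inr hab)).symm
    · rw [Function.update_self, Function.update_of_ne (hv a ha').ne]
      exact hi' a ha' (.inl hab)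
    · rw [Function.update_of_ne (hv a ha').ne, Function.update_of_ne (hv b hb').ne]
      exact hcol a ha' b hb' hab

/-- Two colours leave no room for a triangle. With three, every triangle uses all of them, so the
smallest colour class suffices. -/
theorem IsElimination.exists_hitsTriangles_of_le_two {D : Digraph V} {k : ℕ}
    (h : D.IsElimination k) (hk : k ≤ 2) :
    ∃ F : Finset V, (k + 3) * F.card ≤ k * Fintype.card V ∧ D.HitsTriangles F := by
  obtain ⟨col, hcol⟩ := h.exists_coloring
  rcases (show k ≤ 1 ∨ k = 2 by omega) with hk | rfl
  · refine ⟨∅, by simp, ?_⟩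
    intro a b c _ _ _ hab hbc hca
    have := hcol _ _ hab
    have := hcol _ _ hbc
    have := hcol _ _ hca
    omega
  · obtain ⟨i, hi⟩ : ∃ i, 3 * (Finset.univ.filter fun v => col v = i).card ≤ Fintype.card V := by
      by_contra! hall
      have hsum := Finset.card_eq_sum_card_fiberwise (f := col) (s := Finset.univ)
        (t := Finset.univ) (fun _ _ => by simp)
      rw [Finset.card_univ, Fin.sum_univ_three] at hsum
      have h0 := hall 0
      have h1 := hall 1
      have h2 := hall 2
      omega
    refine ⟨Finset.univ.filter fun v => col v = i, by omega, ?_⟩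
    intro a b c ha hb hc hab hbc hca
    simp only [Finset.mem_filter, Finset.mem_univ, true_and] at ha hb hc
    have := hcol _ _ hab
    have := hcol _ _ hbc
    have := hcol _ _ hca
    omega

/-! ### Reductions -/

theorem exists_hitsTriangles_of_isSafe {D : Digraph V} {k : ℕ} {X Y : Finset V}
    (hXY : Disjoint X Y) (hcard : 3 * X.card ≤ k * Y.card) (hsafe : D.IsSafe X Y)
    (hrec : ∃ F : Finset {v // v ∉ X ∪ Y}, (k + 3) * F.card ≤ k * Fintype.card {v // v ∉ X ∪ Y} ∧
      (D.deleteVertices (X ∪ Y)).HitsTriangles F) :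
    ∃ F : Finset V, (k + 3) * F.card ≤ k * Fintype.card V ∧ D.HitsTriangles F := by
  obtain ⟨F, hF, hhit⟩ := hrec
  refine ⟨X ∪ F.map (Function.Embedding.subtype _), ?_, ?_⟩
  · have h1 : (X ∪ F.map (Function.Embedding.subtype _)).card ≤ X.card + F.card :=
      (Finset.card_union_le _ _).trans (by rw [Finset.card_map])
    have h2 : Fintype.card {v // v ∉ X ∪ Y} + X.card + Y.card = Fintype.card V := by
      rw [add_assoc, ← Finset.card_union_of_disjoint hXY, Fintype.card_subtype_compl,
        Fintype.card_coe]
      exact Nat.sub_add_cancel (Finset.card_le_univ _)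
    calc (k + 3) * (X ∪ F.map (Function.Embedding.subtype _)).card
        ≤ (k + 3) * (X.card + F.card) := Nat.mul_le_mul_left _ h1
      _ = k * X.card + 3 * X.card + (k + 3) * F.card := by ring
      _ ≤ k * X.card + k * Y.card + k * Fintype.card {v // v ∉ X ∪ Y} := by omega
      _ = k * Fintype.card V := by rw [← h2]; ring
  · intro a b c ha hb hc hab hbc hca
    rw [Finset.mem_union, not_or] at ha hb hc
    by_cases haY : a ∈ Y
    · exact hsafe a haY b c hb.1 hc.1 hab hbc hca
    by_cases hbY : b ∈ Y
    · exact hsafe b hbY c a hc.1 ha.1 hbc hca hab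
    by_cases hcY : c ∈ Y
    · exact hsafe c hcY a b ha.1 hb.1 hca hab hbc
    have key : ∀ x, x ∉ X → x ∉ Y → x ∉ X ∪ Y := fun x h1 h2 => by simp [h1, h2]
    have key' : ∀ x (hx : x ∉ X ∪ Y), x ∉ F.map (Function.Embedding.subtype _) → ⟨x, hx⟩ ∉ F :=
      fun x hx h1 h2 => h1 (Finset.mem_map.2 ⟨⟨x, hx⟩, h2, rfl⟩)
    exact hhit ⟨a, key a ha.1 haY⟩ ⟨b, key b hb.1 hbY⟩ ⟨c, key c hc.1 hcY⟩ (key' _ _ ha.2)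
      (key' _ _ hb.2) (key' _ _ hc.2) hab hbc hca

variable {D : Digraph V} {k : ℕ}

/-! ### The tree structure of an elimination order -/

/-- `v` is a child of `z`: the last lower neighbour of `v` is `z`. -/
def IsChild (D : Digraph V) (z v : V) : Prop := z ∈ D.lower v ∧ ∀ x ∈ D.lower v, x ≤ z

/-- `v` has no neighbours after it. -/
def IsLeaf (D : Digraph V) (v : V) : Prop := ∀ a, D.Joined v a → a < v

/-- The only neighbour of `u` after it is the leaf `c`. -/
def IsEdgeBranch (D : Digraph V) (u c : V) : Prop :=
  u < c ∧ D.Joined u c ∧ D.IsLeaf c ∧ ∀ a, D.Joined u a → a < u ∨ a = c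

/-- `T` is a directed triangle with first vertex `w`, whose only neighbours outside are
lower neighbours of `w`. -/
def IsTriangleBranch (D : Digraph V) (w : V) (T : Finset V) : Prop :=
  w ∈ T ∧ (∀ t ∈ T, w ≤ t ∧ ∀ x, D.Joined t x → x ∈ T ∨ x ∈ D.lower w) ∧
    ∃ a b c, T = {a, b, c} ∧ D.Adj a b ∧ D.Adj b c ∧ D.Adj c a

theorem IsChild.lt {z v : V} (h : D.IsChild z v) : z < v := (mem_lower.1 h.1).1

theorem IsChild.joined {z v : V} (h : D.IsChild z v) : D.Joined z v := (mem_lower.1 h.1).2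

theorem exists_isChild {x v : V} (hx : x ∈ D.lower v) : ∃ z, D.IsChild z v ∧ x ≤ z :=
  ⟨(D.lower v).max' ⟨x, hx⟩, ⟨Finset.max'_mem _ _, fun y hy => Finset.le_max' _ y hy⟩,
    Finset.le_max' _ x hx⟩

theorem IsElimination.lower_subset (h : D.IsElimination k) {z v : V} (hzv : D.IsChild z v) :
    D.lower v ⊆ insert z (D.lower z) := by
  intro x hx
  rcases eq_or_ne x z with rfl | hxz
  · exact Finset.mem_insert_self _ _
  · exact Finset.mem_insert_of_mem (mem_lower.2
      ⟨lt_of_le_of_ne (hzv.2 x hx) hxz, h.clique v x hx z hzv.1 hxz⟩)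

/-- A set that contains the children of `v`, and the later neighbours of its own members,
contains the later neighbours of `v`. -/
theorem IsElimination.mem_of_joined (h : D.IsElimination k) {v : V} {S : Set V}
    (hchild : ∀ a, D.IsChild v a → a ∈ S) (hS : ∀ s ∈ S, ∀ a, s < a → D.Joined s a → a ∈ S)
    (a : V) (hva : v < a) (hadj : D.Joined v a) : a ∈ S := by
  induction a using WellFoundedLT.induction with
  | ind a ih =>
    -- The parent of `a` is `v` itself or, by the clique condition, an earlier instance of the
    -- claim.
    obtain ⟨z, hz, hvz⟩ := exists_isChild (mem_lower.2 ⟨hva, hadj⟩)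
    rcases eq_or_lt_of_le hvz with rfl | hvz
    · exact hchild a hz
    · exact hS z (ih z hz.lt hvz (h.clique a v (mem_lower.2 ⟨hva, hadj⟩) z hz.1 hvz.ne)) a
        hz.lt hz.joined

theorem le_of_mem_bag {z x : V} (hx : x ∈ insert z (D.lower z)) : x ≤ z := by
  rcases Finset.mem_insert.1 hx with rfl | hx
  · exact le_rfl
  · exact (mem_lower.1 hx).1.le

theorem IsLeaf.mem_lower {v x : V} (hv : D.IsLeaf v) (hx : D.Joined v x) : x ∈ D.lower v :=
  Digraph.mem_lower.2 ⟨hv x hx, hx.symm⟩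

theorem IsEdgeBranch.mem_lower {u c x : V} (hu : D.IsEdgeBranch u c) (hx : D.Joined u x) :
    x ∈ D.lower u ∨ x = c :=
  (hu.2.2.2 x hx).imp_left fun h => Digraph.mem_lower.2 ⟨h, hx.symm⟩

theorem IsEdgeBranch.mem_lower_right (h : D.IsElimination k) {u c x : V}
    (hu : D.IsEdgeBranch u c) (hx : D.Joined c x) : x = u ∨ x ∈ D.lower u := by
  have hxc := hu.2.2.1.mem_lower hx
  rcases eq_or_ne x u with rfl | hxu
  · exact .inl rfl
  · have h1 := h.clique c x hxc u (Digraph.mem_lower.2 ⟨hu.1, hu.2.1⟩) hxu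
    rcases hu.mem_lower h1.symm with h2 | rfl
    · exact .inr h2
    · exact (h.oriented.not_joined_self _ hx).elim

/-! ### Choosing the vertices of a bag to be kept -/

/-- A bag of `k+1` vertices cannot lie inside `D.lower v`, which contains `z`; so it has a vertex
other than `z` that `v` does not see. Sparing that vertex brings the deletions in the bag down to
`k`. -/
theorem IsElimination.exists_avoiding (h : D.IsElimination k) (hk : 1 ≤ k) {z v : V}
    (hzv : D.IsChild z v) :
    ∃ R ⊆ D.lower z, Disjoint R (D.lower v) ∧ R.card ≤ 1 ∧ (D.lower z \ R).card + 1 ≤ k := by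
  by_cases hc : (D.lower z).card + 1 ≤ k
  · exact ⟨∅, by simp, by simp, by simp, by simpa using hc⟩
  · have hz := h.card_le z
    have hv := h.card_le v
    obtain ⟨r, hr, hrv⟩ : ∃ r ∈ D.lower z, r ∉ D.lower v := by
      by_contra! hall
      have : insert z (D.lower z) ⊆ D.lower v := Finset.insert_subset hzv.1 hall
      have := Finset.card_le_card this
      rw [Finset.card_insert_of_notMem notMem_lower_self] at this
      omega
    refine ⟨{r}, by simpa using hr, by simpa using hrv, by simp, ?_⟩
    rw [Finset.card_sdiff_of_subset (by simpa using hr), Finset.card_singleton]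
    omega

theorem card_bag_sdiff_le {z : V} {R : Finset V} {m : ℕ} (hR : (D.lower z \ R).card + 1 ≤ m) :
    (insert z (D.lower z) \ R).card ≤ m := by
  refine le_trans (Finset.card_le_card (t := insert z (D.lower z \ R)) ?_)
    ((Finset.card_insert_le _ _).trans hR)
  intro x
  simp only [Finset.mem_sdiff, Finset.mem_insert]
  tauto

theorem card_bag_sdiff_insert {z : V} {R : Finset V} {m : ℕ}
    (hR : (D.lower z \ R).card + 1 ≤ m) :
    (insert z (D.lower z) \ insert z R).card + 1 ≤ m := by
  refine le_trans (Nat.succ_le_succ (Finset.card_le_card (t := D.lower z \ R) ?_)) hR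
  intro x
  simp only [Finset.mem_sdiff, Finset.mem_insert]
  tauto

/-- `P` is the part of the bag to be spared: each child keeps at most one earlier neighbour, and the
at most `k-1` deletions leave room for a vertex inside a branch. -/
theorem IsElimination.exists_meeting_once (h : D.IsElimination k) (hk : 1 ≤ k) {z v w : V}
    (hv : D.IsChild z v) (hw : D.IsChild z w) :
    ∃ P : Finset V, (P ∩ D.lower v).card ≤ 1 ∧ (P ∩ D.lower w).card ≤ 1 ∧
      (insert z (D.lower z) \ P).card + 1 ≤ k := by
  obtain ⟨R, hRz, hRv, hR1, hRk⟩ := h.exists_avoiding hk hv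
  obtain ⟨Q, hQz, hQw, hQ1, hQk⟩ := h.exists_avoiding hk hw
  by_cases hRw : Disjoint R (D.lower w)
  · exact ⟨insert z R, card_insert_inter_le_one hRv, card_insert_inter_le_one hRw,
      card_bag_sdiff_insert hRk⟩
  by_cases hQv : Disjoint Q (D.lower v)
  · exact ⟨insert z Q, card_insert_inter_le_one hQv, card_insert_inter_le_one hQw,
      card_bag_sdiff_insert hQk⟩
  -- Now `r` is seen only by `w` and `q` only by `v`, so the two can be spared together, instead of
  -- `z` and one of them.
  obtain ⟨r, hrR, hrw⟩ := Finset.not_disjoint_iff.1 hRw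
  obtain ⟨q, hqQ, hqv⟩ := Finset.not_disjoint_iff.1 hQv
  have hrv := Finset.disjoint_left.1 hRv hrR
  have hqw := Finset.disjoint_left.1 hQw hqQ
  have hrq : r ≠ q := by
    rintro rfl
    exact hqw hrw
  refine ⟨{r, q}, ?_, ?_, ?_⟩
  · refine le_trans (Finset.card_le_card (t := {q}) ?_) (by simp)
    intro x
    simp only [Finset.mem_inter, Finset.mem_insert, Finset.mem_singleton]
    rintro ⟨rfl | rfl, hx⟩
    · exact (hrv hx).elim
    · rfl
  · refine le_trans (Finset.card_le_card (t := {r}) ?_) (by simp)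
    intro x
    simp only [Finset.mem_inter, Finset.mem_insert, Finset.mem_singleton]
    rintro ⟨rfl | rfl, hx⟩
    · rfl
    · exact (hqw hx).elim
  · have hsub : ({r, q} : Finset V) ⊆ insert z (D.lower z) := by
      intro x
      simp only [Finset.mem_insert, Finset.mem_singleton]
      rintro (rfl | rfl)
      · exact .inr (hRz hrR)
      · exact .inr (hQz hqQ)
    have h1 := Finset.card_le_card hsub
    rw [Finset.card_sdiff_of_subset hsub]
    rw [Finset.card_pair hrq] at h1 ⊢
    rw [Finset.card_insert_of_notMem notMem_lower_self] at h1 ⊢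
    have := h.card_le z
    omega

/-! ### Safe parts of branches -/

/-- A triangle at a leaf needs two surviving earlier neighbours. -/
theorem IsLeaf.isSafe (hD : D.IsOriented) {v : V} (hv : D.IsLeaf v) {X : Finset V}
    (hX : (D.lower v \ X).card ≤ 1) : D.IsSafe X {v} := by
  intro a ha b c hb hc hab hbc hca
  rw [Finset.mem_singleton] at ha
  subst ha
  have h1 : b ∈ D.lower a \ X := Finset.mem_sdiff.2 ⟨hv.mem_lower (.inl hab), hb⟩
  have h2 : c ∈ D.lower a \ X := Finset.mem_sdiff.2 ⟨hv.mem_lower (.inr hca), hc⟩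
  have := Finset.card_le_one.1 hX b h1 c h2
  subst this
  exact hD.irrefl _ hbc

/-- After the deletion, `u` and `c` have no neighbours but each other. -/
theorem IsEdgeBranch.isSafe (h : D.IsElimination k) {u c : V} (hu : D.IsEdgeBranch u c)
    {X : Finset V} (hX : D.lower u ⊆ X) : D.IsSafe X {u, c} := by
  have hirr := h.oriented.irrefl
  have hu1 : ∀ x, x ∉ X → D.Joined u x → x = c := fun x hx hux =>
    (hu.mem_lower hux).resolve_left fun h => hx (hX h)
  have hc1 : ∀ x, x ∉ X → D.Joined c x → x = u := fun x hx hux =>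
    (hu.mem_lower_right h hux).resolve_right fun h => hx (hX h)
  intro a ha b d hb hd hab hbd hda
  have : b = d := by
    rw [Finset.mem_insert, Finset.mem_singleton] at ha
    rcases ha with rfl | rfl
    · exact (hu1 b hb (.inl hab)).trans (hu1 d hd (.inr hda)).symm
    · exact (hc1 b hb (.inl hab)).trans (hc1 d hd (.inr hda)).symm
  subst this
  exact hirr _ hbd

theorem IsTriangleBranch.card_eq (hD : D.IsOriented) {w : V} {T : Finset V}
    (hT : D.IsTriangleBranch w T) : T.card = 3 := by
  obtain ⟨-, -, a, b, c, rfl, hab, hbc, hca⟩ := hT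
  have hirr := hD.irrefl
  refine Finset.card_eq_three.2 ⟨a, b, c, ?_, ?_, ?_, rfl⟩ <;> rintro rfl
  · exact hirr _ hab
  · exact hirr _ hca
  · exact hirr _ hbc

/-- Among a vertex `p` and two of the vertices of a directed triangle, the latter suitably chosen,
there is no directed triangle. -/
theorem IsTriangleBranch.exists_isSafe (hD : D.IsOriented) {w : V} {T X : Finset V}
    (hT : D.IsTriangleBranch w T) (hX : (D.lower w \ X).card ≤ 1) :
    ∃ q ∈ T, D.IsSafe (insert q X) (T.erase q) := by
  have hirr := hD.irrefl
  obtain ⟨p, hp⟩ : ∃ p, D.lower w \ X ⊆ {p} :=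
    haveI : Nonempty V := ⟨w⟩
    Finset.card_le_one_iff_subset_singleton.1 hX
  have hnbr : ∀ t ∈ T, ∀ x, D.Joined t x → x ∉ X → x ∈ T ∨ x = p := by
    intro t ht x htx hx
    rcases (hT.2.1 t ht).2 x htx with h1 | h1
    · exact .inl h1
    · exact .inr (Finset.mem_singleton.1 (hp (Finset.mem_sdiff.2 ⟨h1, hx⟩)))
  obtain ⟨-, -, a, b, c, rfl, hab, hbc, hca⟩ := hT
  simp only [Finset.mem_insert, Finset.mem_singleton] at hnbr
  have key : ∀ q ∈ ({a, b, c} : Finset V),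
      (∀ x ∈ ({a, b, c} : Finset V), ∀ y ∈ ({a, b, c} : Finset V), x ≠ q → y ≠ q →
        D.Adj x y → D.Adj y p → D.Adj p x → False) →
      D.IsSafe (insert q X) (({a, b, c} : Finset V).erase q) := by
    intro q hq hsafe x hx y d hy hd hxy hyd hdx
    simp only [Finset.mem_insert, Finset.mem_singleton, Finset.mem_erase, not_or] at *
    have h1 := hnbr x hx.2 y (.inl hxy) hy.2
    have h2 := hnbr x hx.2 d (.inr hdx) hd.2
    unfold IsOriented at hD
    grind
  unfold IsOriented at hD
  -- With `b` deleted, the arc `c → a` needs `p → c` to form a triangle with `p`, which `c → p`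
  -- rules out. With `a` deleted, `b → c` needs exactly the two arcs of this case distinction.
  by_cases h2 : D.Adj c p ∧ D.Adj p b
  · refine ⟨b, by simp, key b (by simp) ?_⟩
    simp only [Finset.mem_insert, Finset.mem_singleton]
    grind
  · refine ⟨a, by simp, key a (by simp) ?_⟩
    simp only [Finset.mem_insert, Finset.mem_singleton]
    grind

/-! ### Reductions at a vertex all of whose children are understood -/

theorem IsElimination.mem_lower_or_lt (h : D.IsElimination k) {v a : V} (ha : D.Joined v a) :
    a ∈ D.lower v ∨ v < a := by
  rcases lt_trichotomy a v with h1 | rfl | h1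
  · exact .inl (mem_lower.2 ⟨h1, ha.symm⟩)
  · exact (h.oriented.not_joined_self _ ha).elim
  · exact .inr h1

theorem IsElimination.card_lower_sdiff_le (h : D.IsElimination k) {z v : V} {X R : Finset V}
    (hzv : D.IsChild z v) (hX : insert z (D.lower z) \ R ⊆ X) (hR : (R ∩ D.lower v).card ≤ 1) :
    (D.lower v \ X).card ≤ 1 := by
  refine le_trans (Finset.card_le_card ?_) hR
  intro x hx
  rw [Finset.mem_sdiff] at hx
  rw [Finset.mem_inter]
  refine ⟨?_, hx.1⟩
  by_contra hxR
  exact hx.2 (hX (Finset.mem_sdiff.2 ⟨h.lower_subset hzv hx.1, hxR⟩))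

theorem IsElimination.lower_subset_sdiff (h : D.IsElimination k) {z v : V} {R : Finset V}
    (hzv : D.IsChild z v) (hR : Disjoint R (D.lower v)) :
    D.lower v ⊆ insert z (D.lower z) \ R := fun _ hx =>
  Finset.mem_sdiff.2 ⟨h.lower_subset hzv hx, fun hxR => Finset.disjoint_left.1 hR hxR hx⟩

/-- The cases are no child, one child, and at least two. In the last, deleting `D.lower v` leaves a
star around `v`, since leaves are never joined to each other; this makes `v` and two children safe.
-/
theorem IsElimination.branch_of_leaf_children (h : D.IsElimination k) (hk : 3 ≤ k) {v : V}
    (hall : ∀ a, D.IsChild v a → D.IsLeaf a) :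
    D.IsLeaf v ∨ (∃ c, D.IsEdgeBranch v c) ∨ D.IsReducible k := by
  have hlater : ∀ a, v < a → D.Joined v a → D.IsChild v a :=
    h.mem_of_joined (S := {a | D.IsChild v a}) (fun _ ha => ha)
      fun s hs a hsa hj => absurd (hall s hs a hj) hsa.asymm
  by_cases hex : ∃ c, D.IsChild v c
  swap
  · left
    intro a ha
    rcases h.mem_lower_or_lt ha with h1 | h1
    · exact (mem_lower.1 h1).1
    · exact (hex ⟨a, hlater a h1 ha⟩).elim
  right
  obtain ⟨c, hc⟩ := hex
  by_cases huniq : ∀ c', D.IsChild v c' → c' = c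
  · left
    refine ⟨c, hc.lt, hc.joined, hall c hc, fun a ha => ?_⟩
    rcases h.mem_lower_or_lt ha with h1 | h1
    · exact .inl (mem_lower.1 h1).1
    · exact .inr (huniq a (hlater a h1 ha))
  right
  push Not at huniq
  obtain ⟨c', hc', hne⟩ := huniq
  have hsafe : ∀ x, D.IsChild v x → D.IsSafe (D.lower v) {x} := by
    intro x hx
    refine (hall x hx).isSafe h.oriented
      (h.card_lower_sdiff_le (R := {v}) hx ?_ ?_)
    · intro y
      simp only [Finset.mem_sdiff, Finset.mem_insert, Finset.mem_singleton]
      tauto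
    · exact (Finset.card_le_card Finset.inter_subset_left).trans (by simp)
  have hv : D.IsSafe (D.lower v) {v} := by
    intro a ha b d hb hd hab hbd hda
    rw [Finset.mem_singleton] at ha
    subst ha
    have h1 := hlater b ((h.mem_lower_or_lt (.inl hab)).resolve_left hb) (.inl hab)
    have h2 := hlater d ((h.mem_lower_or_lt (.inr hda)).resolve_left hd) (.inr hda)
    exact (hall b h1 d (.inl hbd)).asymm (hall d h2 b (.inr hbd))
  refine isReducible_of_card hk 0 (X := D.lower v) (Y := {v} ∪ ({c} ∪ {c'})) ?_
    (h.card_le v) ?_ (hv.union ((hsafe c hc).union (hsafe c' hc')))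
  · rw [Finset.disjoint_left]
    intro x hx
    have hxv := (mem_lower.1 hx).1
    simp only [Finset.mem_union, Finset.mem_singleton, not_or]
    exact ⟨hxv.ne, (hxv.trans hc.lt).ne, (hxv.trans hc'.lt).ne⟩
  · have : ({v} ∪ ({c} ∪ {c'}) : Finset V) = {v, c, c'} := rfl
    rw [this, Finset.card_eq_three.2 ⟨v, c, c', hc.lt.ne, hc'.lt.ne, hne.symm, rfl⟩]

theorem IsEdgeBranch.ne_of_isChild {w u c u' : V} (hc : D.IsEdgeBranch u c) (hu : D.IsChild w u)
    (hu' : D.IsChild w u') : c ≠ u' := by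
  rintro rfl
  exact (hu'.2 u (Digraph.mem_lower.2 ⟨hc.1, hc.2.1⟩)).not_gt hu.lt

/-- The spared vertex is one that `u` does not see; a leaf tolerates one survivor, so `k` deletions
make three vertices safe. -/
theorem IsElimination.isReducible_of_edgeBranch_leaf (h : D.IsElimination k) (hk : 3 ≤ k)
    {w u c u' : V} (hu : D.IsChild w u) (hc : D.IsEdgeBranch u c) (hu' : D.IsChild w u')
    (hne : u ≠ u') (hleaf : D.IsLeaf u') : D.IsReducible k := by
  obtain ⟨R, -, hRu, hR1, hRk⟩ := h.exists_avoiding (by omega) hu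
  refine isReducible_of_card hk 0 (X := insert w (D.lower w) \ R) (Y := {u, c} ∪ {u'}) ?_
    (card_bag_sdiff_le hRk) ?_ (.union ?_ ?_)
  · rw [Finset.disjoint_left]
    intro x hx
    have hxw := le_of_mem_bag (Finset.mem_sdiff.1 hx).1
    have h1 := hxw.trans_lt hu.lt
    simp only [Finset.mem_union, Finset.mem_singleton, Finset.mem_insert, not_or]
    exact ⟨⟨h1.ne, (h1.trans hc.1).ne⟩, (hxw.trans_lt hu'.lt).ne⟩
  · have : ({u, c} ∪ {u'} : Finset V) = {u, c, u'} := by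
      rw [Finset.insert_union]; rfl
    rw [this, Finset.card_eq_three.2
      ⟨u, c, u', hc.1.ne, hne, hc.ne_of_isChild hu hu', rfl⟩]
  · exact hc.isSafe h (h.lower_subset_sdiff hu hRu)
  · exact hleaf.isSafe h.oriented (h.card_lower_sdiff_le hu' subset_rfl
      ((Finset.card_le_card Finset.inter_subset_left).trans hR1))

/-- Deleting the whole bag is affordable here: at most `k+1` deletions, four safe vertices. -/
theorem IsElimination.isReducible_of_edgeBranch_edgeBranch (h : D.IsElimination k) (hk : 3 ≤ k)
    {w u c u' c' : V} (hu : D.IsChild w u) (hc : D.IsEdgeBranch u c) (hu' : D.IsChild w u')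
    (hne : u ≠ u') (hc' : D.IsEdgeBranch u' c') : D.IsReducible k := by
  have hcc : c ≠ c' := by
    rintro rfl
    have hj := h.clique c u (mem_lower.2 ⟨hc.1, hc.2.1⟩) u' (mem_lower.2 ⟨hc'.1, hc'.2.1⟩) hne
    rcases hc.mem_lower hj with h1 | h1
    · exact (hu.2 u' h1).not_gt hu'.lt
    · exact hc.ne_of_isChild hu hu' h1.symm
  refine isReducible_of_card hk 1 (X := insert w (D.lower w)) (Y := {u, c} ∪ {u', c'}) ?_
    ((Finset.card_insert_le _ _).trans (Nat.succ_le_succ (h.card_le w))) ?_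
    (.union (hc.isSafe h (h.lower_subset hu)) (hc'.isSafe h (h.lower_subset hu')))
  · rw [Finset.disjoint_left]
    intro x hx
    have hxw := le_of_mem_bag hx
    have h1 := hxw.trans_lt hu.lt
    have h2 := hxw.trans_lt hu'.lt
    simp only [Finset.mem_union, Finset.mem_singleton, Finset.mem_insert, not_or]
    exact ⟨⟨h1.ne, (h1.trans hc.1).ne⟩, h2.ne, (h2.trans hc'.1).ne⟩
  · rw [Finset.card_union_of_disjoint, Finset.card_pair hc.1.ne, Finset.card_pair hc'.1.ne]
    have h1 := hc.ne_of_isChild hu hu'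
    have h2 := hc'.ne_of_isChild hu' hu
    simp [hne.symm, hcc.symm, h1.symm, h2]

/-- Outside `{w, u, c}` these vertices see only `D.lower w`. Unless they form a directed triangle,
deleting `D.lower w` makes all three safe. -/
theorem IsElimination.branch_of_only_edgeBranch (h : D.IsElimination k) (hk : 3 ≤ k) {w u c : V}
    (hu : D.IsChild w u) (hc : D.IsEdgeBranch u c) (huniq : ∀ a, D.IsChild w a → a = u) :
    (∃ T, D.IsTriangleBranch w T) ∨ D.IsReducible k := by
  have hlater : ∀ a, w < a → D.Joined w a → a = u ∨ a = c := by
    refine h.mem_of_joined (S := {a | a = u ∨ a = c}) (fun a ha => .inl (huniq a ha)) ?_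
    rintro s (rfl | rfl) a hsa hj
    · exact .inr ((hc.2.2.2 a hj).resolve_left hsa.asymm)
    · exact absurd (hc.2.2.1 a hj) hsa.asymm
  have hnbr : ∀ t ∈ ({w, u, c} : Finset V), ∀ x, D.Joined t x →
      x ∈ ({w, u, c} : Finset V) ∨ x ∈ D.lower w := by
    have hsub : ∀ x ∈ D.lower u, x = w ∨ x ∈ D.lower w := fun x hx =>
      Finset.mem_insert.1 (h.lower_subset hu hx)
    intro t ht x hx
    simp only [Finset.mem_insert, Finset.mem_singleton] at ht ⊢
    rcases ht with rfl | rfl | rfl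
    · rcases h.mem_lower_or_lt hx with h1 | h1
      · exact .inr h1
      · have := hlater x h1 hx
        tauto
    · rcases hc.mem_lower hx with h1 | h1
      · have := hsub x h1
        tauto
      · tauto
    · rcases hc.mem_lower_right h hx with h1 | h1
      · tauto
      · have := hsub x h1
        tauto
  have hle : ∀ t ∈ ({w, u, c} : Finset V), w ≤ t := by
    intro t ht
    simp only [Finset.mem_insert, Finset.mem_singleton] at ht
    rcases ht with rfl | rfl | rfl
    · exact le_rfl
    · exact hu.lt.le
    · exact (hu.lt.trans hc.1).le
  by_cases hcyc : (D.Adj w u ∧ D.Adj u c ∧ D.Adj c w) ∨ (D.Adj w c ∧ D.Adj c u ∧ D.Adj u w)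
  · left
    refine ⟨{w, u, c}, by simp, fun t ht => ⟨hle t ht, hnbr t ht⟩, ?_⟩
    rcases hcyc with hcyc | hcyc
    · exact ⟨w, u, c, rfl, hcyc⟩
    · exact ⟨w, c, u, by rw [Finset.pair_comm], hcyc⟩
  · right
    refine isReducible_of_card hk 0 (X := D.lower w) (Y := {w, u, c}) ?_ (h.card_le w) ?_ ?_
    · rw [Finset.disjoint_left]
      exact fun x hx hxY => (mem_lower.1 hx).1.not_ge (hle x hxY)
    · rw [Finset.card_eq_three.2 ⟨w, u, c, hu.lt.ne, (hu.lt.trans hc.1).ne, hc.1.ne, rfl⟩]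
    · intro a ha b d hb hd hab hbd hda
      have h1 := (hnbr a ha b (.inl hab)).resolve_right hb
      have h2 := (hnbr a ha d (.inr hda)).resolve_right hd
      have hirr := h.oriented.irrefl
      have hor := h.oriented
      unfold IsOriented at hor
      simp only [Finset.mem_insert, Finset.mem_singleton] at ha h1 h2
      grind

/-! ### Reductions at a vertex with a triangle branch -/

theorem IsTriangleBranch.eq_of_mem {z w w' : V} {T : Finset V} (hT : D.IsTriangleBranch w T)
    (hw : D.IsChild z w) (hw' : D.IsChild z w') (hmem : w' ∈ T) : w' = w := by
  by_contra hne
  obtain ⟨hwT, hT1, a, b, c, rfl, hab, hbc, hca⟩ := hT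
  have hj : D.Joined w w' := by
    simp only [Finset.mem_insert, Finset.mem_singleton] at hwT hmem
    unfold Joined
    grind
  have hlt : w < w' := lt_of_le_of_ne (hT1 w' hmem).1 (Ne.symm hne)
  exact (hw'.2 w (mem_lower.2 ⟨hlt, hj⟩)).not_gt hw.lt

theorem IsTriangleBranch.notMem_of_joined {z w w' x : V} {T : Finset V}
    (hT : D.IsTriangleBranch w T) (hw : D.IsChild z w) (hw' : D.IsChild z w') (hne : w ≠ w')
    (hx : D.Joined w' x) : x ∉ T := by
  intro hxT
  rcases (hT.2.1 x hxT).2 w' hx.symm with h1 | h1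
  · exact hne (hT.eq_of_mem hw hw' h1).symm
  · exact (hw.2 w' h1).not_gt hw'.lt

theorem IsTriangleBranch.lt_of_mem {z w x : V} {T : Finset V} (hT : D.IsTriangleBranch w T)
    (hw : D.IsChild z w) (hx : x ∈ T) : z < x := hw.lt.trans_le (hT.2.1 x hx).1

/-- Both branches tolerate one survivor in the bag, so `k-1` deletions there and one in `T` suffice
for three safe vertices. -/
theorem IsElimination.isReducible_of_triangleBranch_leaf (h : D.IsElimination k) (hk : 3 ≤ k)
    {z w w' : V} {T : Finset V} (hw : D.IsChild z w) (hT : D.IsTriangleBranch w T)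
    (hw' : D.IsChild z w') (hne : w ≠ w') (hleaf : D.IsLeaf w') : D.IsReducible k := by
  obtain ⟨P, hP1, hP2, hPk⟩ := h.exists_meeting_once (by omega) hw hw'
  obtain ⟨q, hq, hsafe⟩ := hT.exists_isSafe h.oriented
    (h.card_lower_sdiff_le hw subset_rfl hP1)
  have hw'T : w' ∉ T := fun hm => hne (hT.eq_of_mem hw hw' hm).symm
  refine isReducible_of_card hk 0 (X := insert q (insert z (D.lower z) \ P))
    (Y := T.erase q ∪ {w'}) ?_ ((Finset.card_insert_le _ _).trans hPk) ?_ (hsafe.union ?_)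
  · rw [Finset.disjoint_left]
    intro x hx hxY
    simp only [Finset.mem_union, Finset.mem_erase, Finset.mem_singleton] at hxY
    rcases Finset.mem_insert.1 hx with rfl | hx
    · rcases hxY with hxY | rfl
      · exact hxY.1 rfl
      · exact hw'T hq
    · have hxz := le_of_mem_bag (Finset.mem_sdiff.1 hx).1
      rcases hxY with hxY | rfl
      · exact (hT.lt_of_mem hw hxY.2).not_ge hxz
      · exact hw'.lt.not_ge hxz
  · rw [Finset.card_union_of_disjoint, Finset.card_erase_of_mem hq, hT.card_eq h.oriented,
      Finset.card_singleton]
    rw [Finset.disjoint_singleton_right, Finset.mem_erase]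
    exact fun hm => hw'T hm.2
  · exact hleaf.isSafe h.oriented (h.card_lower_sdiff_le hw' (Finset.subset_insert _ _) hP2)

/-- The edge branch tolerates no survivor among its earlier neighbours, so only `R` is spared: at
most `k` deletions in the bag and one in `T`, for four safe vertices. -/
theorem IsElimination.isReducible_of_triangleBranch_edgeBranch (h : D.IsElimination k)
    (hk : 3 ≤ k) {z w w' u' : V} {T : Finset V} (hw : D.IsChild z w)
    (hT : D.IsTriangleBranch w T) (hw' : D.IsChild z w') (hne : w ≠ w')
    (hedge : D.IsEdgeBranch w' u') : D.IsReducible k := by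
  obtain ⟨R, -, hRw', hR1, hRk⟩ := h.exists_avoiding (by omega) hw'
  obtain ⟨q, hq, hsafe⟩ := hT.exists_isSafe h.oriented
    (h.card_lower_sdiff_le hw subset_rfl
      ((Finset.card_le_card Finset.inter_subset_left).trans hR1))
  have hw'T : w' ∉ T := fun hm => hne (hT.eq_of_mem hw hw' hm).symm
  have hu'T : u' ∉ T := hT.notMem_of_joined hw hw' hne hedge.2.1
  refine isReducible_of_card hk 1 (X := insert q (insert z (D.lower z) \ R))
    (Y := T.erase q ∪ {w', u'}) ?_
    ((Finset.card_insert_le _ _).trans (Nat.succ_le_succ (card_bag_sdiff_le hRk))) ?_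
    (hsafe.union (hedge.isSafe h
      ((h.lower_subset_sdiff hw' hRw').trans (Finset.subset_insert _ _))))
  · rw [Finset.disjoint_left]
    intro x hx hxY
    simp only [Finset.mem_union, Finset.mem_erase, Finset.mem_singleton, Finset.mem_insert] at hxY
    rcases Finset.mem_insert.1 hx with rfl | hx
    · rcases hxY with hxY | rfl | rfl
      · exact hxY.1 rfl
      · exact hw'T hq
      · exact hu'T hq
    · have hxz := le_of_mem_bag (Finset.mem_sdiff.1 hx).1
      rcases hxY with hxY | rfl | rfl
      · exact (hT.lt_of_mem hw hxY.2).not_ge hxz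
      · exact hw'.lt.not_ge hxz
      · exact (hw'.lt.trans hedge.1).not_ge hxz
  · rw [Finset.card_union_of_disjoint, Finset.card_erase_of_mem hq, hT.card_eq h.oriented,
      Finset.card_pair hedge.1.ne]
    rw [Finset.disjoint_left]
    intro x hx
    have hxT := Finset.mem_of_mem_erase hx
    simp only [Finset.mem_insert, Finset.mem_singleton]
    rintro (rfl | rfl)
    · exact hw'T hxT
    · exact hu'T hxT

/-- At most `k-1` deletions in the bag and one in each triangle, for four safe vertices. -/
theorem IsElimination.isReducible_of_triangleBranch_triangleBranch (h : D.IsElimination k)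
    (hk : 3 ≤ k) {z w w' : V} {T T' : Finset V} (hw : D.IsChild z w)
    (hT : D.IsTriangleBranch w T) (hw' : D.IsChild z w') (hne : w ≠ w')
    (hT' : D.IsTriangleBranch w' T') : D.IsReducible k := by
  obtain ⟨P, hP1, hP2, hPk⟩ := h.exists_meeting_once (by omega) hw hw'
  obtain ⟨q, hq, hsafe⟩ := hT.exists_isSafe h.oriented
    (h.card_lower_sdiff_le hw subset_rfl hP1)
  obtain ⟨q', hq', hsafe'⟩ := hT'.exists_isSafe h.oriented
    (h.card_lower_sdiff_le hw' subset_rfl hP2)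
  have hTT : Disjoint T T' := by
    rw [Finset.disjoint_left]
    intro x hx hx'
    have hw'T : w' ∉ T := fun hm => hne (hT.eq_of_mem hw hw' hm).symm
    have hxw : x ≠ w' := by
      rintro rfl
      exact hw'T hx
    refine hT.notMem_of_joined hw hw' hne ?_ hx
    obtain ⟨hw'T', -, a, b, c, rfl, hab, hbc, hca⟩ := hT'
    simp only [Finset.mem_insert, Finset.mem_singleton] at hw'T' hx'
    unfold Joined
    grind
  refine isReducible_of_card hk 1
    (X := insert q (insert q' (insert z (D.lower z) \ P))) (Y := T.erase q ∪ T'.erase q') ?_ ?_ ?_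
    ((hsafe.mono ?_).union (hsafe'.mono (Finset.subset_insert _ _)))
  · rw [Finset.disjoint_left]
    intro x hx hxY
    simp only [Finset.mem_union, Finset.mem_erase] at hxY
    rcases Finset.mem_insert.1 hx with rfl | hx
    · rcases hxY with hxY | hxY
      · exact hxY.1 rfl
      · exact Finset.disjoint_left.1 hTT hq hxY.2
    rcases Finset.mem_insert.1 hx with rfl | hx
    · rcases hxY with hxY | hxY
      · exact Finset.disjoint_left.1 hTT hxY.2 hq'
      · exact hxY.1 rfl
    · have hxz := le_of_mem_bag (Finset.mem_sdiff.1 hx).1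
      rcases hxY with hxY | hxY
      · exact (hT.lt_of_mem hw hxY.2).not_ge hxz
      · exact (hT'.lt_of_mem hw' hxY.2).not_ge hxz
  · exact (Finset.card_insert_le _ _).trans
      (Nat.succ_le_succ ((Finset.card_insert_le _ _).trans hPk))
  · rw [Finset.card_union_of_disjoint, Finset.card_erase_of_mem hq, Finset.card_erase_of_mem hq',
      hT.card_eq h.oriented, hT'.card_eq h.oriented]
    exact hTT.mono (Finset.erase_subset _ _) (Finset.erase_subset _ _)
  · exact Finset.insert_subset_insert _ (Finset.subset_insert _ _)

/-- Here `z` is kept and becomes the third safe vertex: its later neighbours all lie in `T`, and `z`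
is the only survivor of its bag that `w` can see. -/
theorem IsElimination.isReducible_of_only_triangleBranch (h : D.IsElimination k) (hk : 3 ≤ k)
    {z w : V} {T : Finset V} (hw : D.IsChild z w) (hT : D.IsTriangleBranch w T)
    (huniq : ∀ a, D.IsChild z a → a = w) : D.IsReducible k := by
  have hlater : ∀ a, z < a → D.Joined z a → a ∈ T := by
    refine h.mem_of_joined (S := {a | a ∈ T}) (fun a ha => ?_) ?_
    · rw [huniq a ha]
      exact hT.1
    · intro s hs a hsa hj
      rcases (hT.2.1 s hs).2 a hj with h1 | h1
      · exact h1
      · exact absurd ((mem_lower.1 h1).1.trans_le (hT.2.1 s hs).1) hsa.asymm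
  obtain ⟨R, -, hRw, hR1, hRk⟩ := h.exists_avoiding (by omega) hw
  have hX : (D.lower w \ (D.lower z \ R)).card ≤ 1 := by
    refine h.card_lower_sdiff_le (R := insert z R) hw ?_ (card_insert_inter_le_one hRw)
    intro x
    simp only [Finset.mem_sdiff, Finset.mem_insert]
    tauto
  obtain ⟨q, hq, hsafe⟩ := hT.exists_isSafe h.oriented hX
  have hzT : ∀ x ∈ T, z ≠ x := fun x hx => (hT.lt_of_mem hw hx).ne
  refine isReducible_of_card hk 0 (X := insert q (D.lower z \ R)) (Y := T.erase q ∪ {z}) ?_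
    ((Finset.card_insert_le _ _).trans hRk) ?_ (hsafe.union ?_)
  · rw [Finset.disjoint_left]
    intro x hx hxY
    simp only [Finset.mem_union, Finset.mem_erase, Finset.mem_singleton] at hxY
    rcases Finset.mem_insert.1 hx with rfl | hx
    · rcases hxY with hxY | rfl
      · exact hxY.1 rfl
      · exact hzT _ hq rfl
    · have hxz := (mem_lower.1 (Finset.mem_sdiff.1 hx).1).1
      rcases hxY with hxY | rfl
      · exact (hT.lt_of_mem hw hxY.2).asymm hxz
      · exact hxz.ne rfl
  · rw [Finset.card_union_of_disjoint, Finset.card_erase_of_mem hq, hT.card_eq h.oriented,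
      Finset.card_singleton]
    rw [Finset.disjoint_singleton_right, Finset.mem_erase]
    exact fun hm => hzT z hm.2 rfl
  · intro a ha b d hb hd hab hbd hda
    rw [Finset.mem_singleton] at ha
    subst ha
    have haX : a ∉ insert q (D.lower a \ R) := by
      rw [Finset.mem_insert, Finset.mem_sdiff, not_or]
      exact ⟨hzT q hq, fun h1 => notMem_lower_self h1.1⟩
    have hR : ∀ x, x ∉ insert q (D.lower a \ R) → D.Joined a x → x ∈ T.erase q ∨ x ∈ R := by
      intro x hx hj
      rw [Finset.mem_insert, Finset.mem_sdiff, not_or] at hx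
      rcases h.mem_lower_or_lt hj with h1 | h1
      · right
        by_contra hxR
        exact hx.2 ⟨h1, hxR⟩
      · exact .inl (Finset.mem_erase.2 ⟨hx.1, hlater x h1 hj⟩)
    -- A triangle through `z` and a kept vertex of `T` is excluded by `hsafe`; any other would need
    -- two vertices of `R`.
    rcases hR b hb (.inl hab) with h1 | h1
    · exact hsafe b h1 d a hd haX hbd hda hab
    rcases hR d hd (.inr hda) with h2 | h2
    · exact hsafe d h2 a b haX hb hda hab hbd
    · have := Finset.card_le_one.1 hR1 b h1 d h2
      subst this
      exact h.oriented.irrefl _ hbd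

/-! ### The bound for elimination orders -/

theorem IsElimination.branch (h : D.IsElimination k) (hk : 3 ≤ k) (hred : ¬ D.IsReducible k)
    (v : V) : D.IsLeaf v ∨ (∃ c, D.IsEdgeBranch v c) ∨ ∃ T, D.IsTriangleBranch v T := by
  induction v using WellFoundedGT.induction with
  | ind v ih =>
    have ih : ∀ a, D.IsChild v a → _ := fun a ha => ih a ha.lt
    by_cases h3 : ∃ w, D.IsChild v w ∧ ∃ T, D.IsTriangleBranch w T
    · obtain ⟨w, hw, T, hT⟩ := h3
      refine (hred ?_).elim
      by_cases huniq : ∀ a, D.IsChild v a → a = w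
      · exact h.isReducible_of_only_triangleBranch hk hw hT huniq
      push Not at huniq
      obtain ⟨w', hw', hne⟩ := huniq
      rcases ih w' hw' with h1 | ⟨u', h1⟩ | ⟨T', h1⟩
      · exact h.isReducible_of_triangleBranch_leaf hk hw hT hw' hne.symm h1
      · exact h.isReducible_of_triangleBranch_edgeBranch hk hw hT hw' hne.symm h1
      · exact h.isReducible_of_triangleBranch_triangleBranch hk hw hT hw' hne.symm h1
    by_cases h2 : ∃ u, D.IsChild v u ∧ ∃ c, D.IsEdgeBranch u c
    · obtain ⟨u, hu, c, hc⟩ := h2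
      by_cases huniq : ∀ a, D.IsChild v a → a = u
      · exact .inr (.inr ((h.branch_of_only_edgeBranch hk hu hc huniq).resolve_right hred))
      push Not at huniq
      obtain ⟨u', hu', hne⟩ := huniq
      refine (hred ?_).elim
      rcases ih u' hu' with h1 | ⟨c', h1⟩ | h1
      · exact h.isReducible_of_edgeBranch_leaf hk hu hc hu' hne.symm h1
      · exact h.isReducible_of_edgeBranch_edgeBranch hk hu hc hu' hne.symm h1
      · exact (h3 ⟨u', hu', h1⟩).elim
    · have hleaf : ∀ a, D.IsChild v a → D.IsLeaf a := fun a ha =>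
        (ih a ha).resolve_right fun h' =>
          h'.elim (fun h1 => h2 ⟨a, ha, h1⟩) fun h1 => h3 ⟨a, ha, h1⟩
      rcases h.branch_of_leaf_children hk hleaf with h1 | h1 | h1
      · exact .inl h1
      · exact .inr (.inl h1)
      · exact (hred h1).elim

/-- At the first vertex no earlier neighbours need deleting: `X` is empty, or one vertex of a
triangle whose other two become safe. -/
theorem IsElimination.isReducible [Nonempty V] (h : D.IsElimination k) (hk : 3 ≤ k) :
    D.IsReducible k := by
  by_contra hred
  obtain ⟨v, -, hv⟩ := Finset.exists_min_image (Finset.univ : Finset V) id Finset.univ_nonempty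
  have hlow : D.lower v = ∅ := by
    rw [Finset.eq_empty_iff_forall_notMem]
    exact fun x hx => (mem_lower.1 hx).1.not_ge (hv x (Finset.mem_univ _))
  rcases h.branch hk hred v with h1 | ⟨c, h1⟩ | ⟨T, h1⟩
  · exact hred ⟨∅, {v}, by simp, by simp, by simp, h1.isSafe h.oriented (by simp [hlow])⟩
  · exact hred ⟨∅, {v, c}, by simp, by simp, by simp, h1.isSafe h (by simp [hlow])⟩
  · obtain ⟨q, hq, hsafe⟩ := h1.exists_isSafe (X := ∅) h.oriented (by simp [hlow])
    have hcard : (T.erase q).card = 2 := by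
      rw [Finset.card_erase_of_mem hq, h1.card_eq h.oriented]
    refine hred ⟨{q}, T.erase q, by simp, Finset.card_pos.1 (by omega), ?_, by simpa using hsafe⟩
    rw [hcard, Finset.card_singleton]
    omega

end Elimination

section Bound

universe u

theorem IsElimination.exists_hitsTriangles {k : ℕ} (n : ℕ) :
    ∀ (V : Type u) [Fintype V] [LinearOrder V] (D : Digraph V), Fintype.card V = n →
      D.IsElimination k →
      ∃ F : Finset V, (k + 3) * F.card ≤ k * Fintype.card V ∧ D.HitsTriangles F := by
  induction n using Nat.strong_induction_on with
  | _ n ih =>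
    intro V _ _ D hn h
    rcases le_or_gt k 2 with hk | hk
    · exact h.exists_hitsTriangles_of_le_two hk
    rcases isEmpty_or_nonempty V with hV | hV
    · exact ⟨∅, by simp, fun a => hV.elim a⟩
    obtain ⟨X, Y, hXY, ⟨y, hy⟩, hcard, hsafe⟩ := h.isReducible hk
    refine exists_hitsTriangles_of_isSafe hXY hcard hsafe
      (ih _ ?_ _ _ rfl (h.deleteVertices (X ∪ Y)))
    rw [← hn]
    exact Fintype.card_subtype_lt (x := y) (by simp [hy])

end Bound

/-! ### Completing an orientation of a subgraph of a `k`-tree -/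

/-- The arcs of `D`, together with the remaining edges of `G` directed forwards. -/
def complete {V : Type*} [LT V] (D : Digraph V) (G : SimpleGraph V) : Digraph V where
  Adj a b := D.Adj a b ∨ (G.Adj a b ∧ ¬ D.Adj b a ∧ a < b)

theorem complete_joined {V : Type*} [LinearOrder V] {D : Digraph V} {G : SimpleGraph V}
    (hDG : ∀ a b, D.Adj a b → G.Adj a b) {a b : V} : (D.complete G).Joined a b ↔ G.Adj a b := by
  constructor
  · rintro ((h | h) | (h | h))
    · exact hDG _ _ h
    · exact h.1
    · exact (hDG _ _ h).symm
    · exact h.1.symm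
  · intro h
    by_cases h1 : D.Adj a b
    · exact .inl (.inl h1)
    by_cases h2 : D.Adj b a
    · exact .inr (.inl h2)
    rcases lt_or_gt_of_ne h.ne with h3 | h3
    · exact .inl (.inr ⟨h, h2, h3⟩)
    · exact .inr (.inr ⟨h.symm, h1, h3⟩)

theorem IsOriented.complete {V : Type*} [LinearOrder V] {D : Digraph V} (hD : D.IsOriented)
    (G : SimpleGraph V) : (D.complete G).IsOriented := by
  rintro a b (h | h) (h' | h')
  · exact hD a b h h'
  · exact h'.2.1 h
  · exact h.2.1 h'
  · exact h.2.2.asymm h'.2.2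

theorem IsFeedbackVertexSet.mono {V : Type*} {D D' : Digraph V} {F : Finset V}
    (h : ∀ a b, D.Adj a b → D'.Adj a b) (hF : D'.IsFeedbackVertexSet F) :
    D.IsFeedbackVertexSet F :=
  fun ⟨m, c, hc, hadj⟩ => hF ⟨m, c, hc, fun i => h _ _ (hadj i)⟩

theorem exists_isElimination_of_hasTreewidth {V : Type*} [Fintype V] {D : Digraph V}
    (hD : D.IsOriented) {k : ℕ} (hk : D.toSimpleGraphInclusive.HasTreewidth k) :
    ∃ (_ : LinearOrder V) (D' : Digraph V), D'.IsElimination k ∧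
      ∀ a b, D.Adj a b → D'.Adj a b := by
  obtain ⟨m, T, ⟨φ, hφ⟩, ⟨f⟩⟩ := hk
  have hf : Function.Injective f.toHom := f.injective'
  -- The order is pulled back from the `k`-tree. Tree vertices outside the image are lost, so only
  -- the upper bound `k` on earlier neighbours survives.
  let _ : LinearOrder V := LinearOrder.lift' (fun v => φ (f.toHom v)) (φ.injective.comp hf)
  have hlt : ∀ a b : V, a < b ↔ φ (f.toHom a) < φ (f.toHom b) := fun _ _ => Iff.rfl
  have hDG : ∀ a b, D.Adj a b → (T.comap f.toHom).Adj a b := fun a b hab =>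
    f.toHom.map_adj ⟨fun he => hD.irrefl a (by rw [← he] at hab; exact hab), .inl hab⟩
  have hmem : ∀ v, ∀ a ∈ (D.complete (T.comap f.toHom)).lower v,
      f.toHom a ∈ T.predecessors φ (f.toHom v) := by
    intro v a ha
    rw [mem_lower, complete_joined hDG] at ha
    exact ha
  refine ⟨inferInstance, D.complete (T.comap f.toHom), ⟨hD.complete _, ?_, ?_⟩,
    fun a b hab => .inl hab⟩
  · intro v a ha b hb hab
    rw [complete_joined hDG]
    exact (hφ (f.toHom v)).1 (hmem v a ha) (hmem v b hb) (hf.ne hab)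
  · intro v
    refine le_trans ?_ ((hφ (f.toHom v)).2.le.trans (min_le_left _ _))
    rw [← Set.ncard_coe_finset]
    exact Set.ncard_le_ncard_of_injOn f.toHom (hmem v) hf.injOn (Set.toFinite _)

end Digraph

/-! ### The bound for the feedback number -/

theorem theorem5p8 {V : Type*} [Fintype V] (D : Digraph V) (hD : D.IsOriented) (k : ℕ)
    (hk : D.toSimpleGraphInclusive.HasTreewidth k) :
    (D.feedbackNumber : ℝ) ≤ (k : ℝ) / ((k : ℝ) + 3) * (Fintype.card V : ℝ) := by
  obtain ⟨_, D', hD', hsub⟩ := Digraph.exists_isElimination_of_hasTreewidth hD hk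
  obtain ⟨F, hcard, hhit⟩ := Digraph.IsElimination.exists_hitsTriangles _ V D' rfl hD'
  have hF : D.feedbackNumber ≤ F.card :=
    Nat.sInf_le ⟨F, .mono hsub (hD'.isFeedbackVertexSet hhit), rfl⟩
  have hcard' : ((k : ℝ) + 3) * F.card ≤ k * Fintype.card V := by exact_mod_cast hcard
  have hpos : (0 : ℝ) < (k : ℝ) + 3 := by positivity
  rw [div_mul_eq_mul_div, le_div_iff₀ hpos]
  calc (D.feedbackNumber : ℝ) * (k + 3) ≤ F.card * (k + 3) := by gcongr
    _ ≤ k * Fintype.card V := by linarith
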